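/- Let $\mathfrak g=\mathfrak g_{\bar 0}\oplus\mathfrak g_{\bar 1}$ be a finite-dimensional complex super vector space with a non-degenerate bilinear form $(\cdot,\cdot)$ that is super-symmetric, $(x,y)=(-1)^{|x||y|}(y,x)$, and consistent, $(\mathfrak g_{\bar 0},\mathfrak g_{\bar 1})=(\mathfrak g_{\bar 1},\mathfrak g_{\bar 0})=0$. Let $C(\mathfrak g)$ (resp. $\Lambda(\mathfrak g)$) be the unital associative algebra generated by $\mathfrak g$ with the relations $xy+(-1)^{|x||y|}yx=2(x,y)$ (resp. $x\wedge y+(-1)^{|x||y|}y\wedge x=0$) for homogeneous $x,y$. For $z\in\mathfrak g$ let $\epsilon(z)$ be left exterior multiplication by $z$ on $\Lambda(\mathfrak g)$, and let $\iota(z)$ be the contraction: it is linear in $z$, $\iota(z)1=0$, and for homogeneous $z,x\in\mathfrak g$ and $u\in\Lambda(\mathfrak g)$ one has $\iota(z)(x\wedge u)=(z,x)u-(-1)^{|z||x|}x\wedge\iota(z)u$. The map $x\mapsto\epsilon(x)+\iota(x)$ extends to an algebra homomorphism $\gamma:C(\mathfrak g)\to\mathrm{End}\,\Lambda(\mathfrak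 g)$, and $\eta(u)=\gamma(u)1$ is a linear isomorphism $C(\mathfrak g)\to\Lambda(\mathfrak g)$; the Clifford product on $\Lambda(\mathfrak g)$ is transported along $\eta$, and $\phi^2$ denotes the Clifford square of $\phi$. Let $\Lambda^3_{\bar 0}\mathfrak g$ be the span of the $x\wedge y\wedge z$ with $x,y,z$ homogeneous and $|x|+|y|+|z|=\bar 0$, and let $\mathcal V=\{\phi\in\Lambda^3_{\bar 0}\mathfrak g : \phi^2\in\mathbb C\}$. **Theorem.** Let $\phi\in\mathcal V$. Then $[z_1,z_2]=2\iota(z_1)\iota(z_2)\phi$ (an element of $\mathfrak g\subset\Lambda(\mathfrak g)$) defines a Lie superalgebra structure on $\mathfrak g$ for which the form is invariant, $([x,y],z)=(x,[y,z])$. For this Lie superalgebra, the constant $\phi^2$ is $$\phi^2=\frac1{24}\,\mathrm{str}\,\mathrm{ad}(\mathrm{Cas}_{\mathfrak g}).$$ Here $\mathrm{Cas}_{\mathfrak g}=\sum_i x_ix^i\in U(\mathfrak g)$, where $\{x_i\}$ is any basis of $\mathfrak g$ and $\{x^i\}$ is the dual basis, $(x^i,x_j)=\delta_{ij}$; $U(\mathfrak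 g)$ is the universal enveloping algebra; $\mathrm{ad}:U(\mathfrak g)\to\mathrm{End}(\mathfrak g)$ is the extension of the adjoint representation $\mathrm{ad}\,x(y)=[x,y]$; and $\mathrm{str}(T)=\mathrm{tr}(T_{\bar 0\bar 0})-\mathrm{tr}(T_{\bar 1\bar 1})$ is the trace of the diagonal block of $T$ on $\mathfrak g_{\bar 0}$ minus that on $\mathfrak g_{\bar 1}$. -/

import Mathlib

noncomputable section

namespace SuperQuad

/-! ## Super vector spaces, super-symmetric forms, supertrace

A super vector space is a complex vector space `V` with a decomposition `V = 𝒱 0 ⊕ 𝒱 1`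
indexed by `ZMod 2`; `x ∈ 𝒱 i` says that `x` is homogeneous of parity `i`. -/

/-- The sign `(-1)^{ij}` for parities `i, j`. -/
def sgn (i j : ZMod 2) : ℂ := if i = 1 ∧ j = 1 then -1 else 1

theorem sgn_comm (i j : ZMod 2) : sgn i j = sgn j i := by
  simp [sgn, and_comm]

theorem sgn_mul_self (i j : ZMod 2) : sgn i j * sgn i j = 1 := by
  unfold sgn; split_ifs <;> norm_num

theorem parity_cases (i : ZMod 2) : i = 0 ∨ i = 1 := by
  revert i; decide

theorem sgn_add_right (i j k : ZMod 2) : sgn i (j + k) = sgn i j * sgn i k := by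
  have h : (1 : ZMod 2) + 1 = 0 := by decide
  rcases parity_cases i with rfl | rfl <;> rcases parity_cases j with rfl | rfl <;>
    rcases parity_cases k with rfl | rfl <;> simp [sgn, h]

section Basic

variable {V : Type*} [AddCommGroup V] [Module ℂ V] (𝒱 : ZMod 2 → Submodule ℂ V)

/-- A consistent super-symmetric bilinear form on a super vector space. -/
structure SuperForm where
  /-- the underlying bilinear form `(x, y)` -/
  form : LinearMap.BilinForm ℂ V
  /-- consistency: `(x, y) = 0` when `|x| ≠ |y|` -/
  consistent : ∀ i j, i ≠ j → ∀ x ∈ 𝒱 i, ∀ y ∈ 𝒱 j, form x y = 0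
  /-- super-symmetry: `(x, y) = (-1)^{|x||y|} (y, x)` -/
  superSymm : ∀ i j, ∀ x ∈ 𝒱 i, ∀ y ∈ 𝒱 j, form x y = sgn i j * form y x

/-- The zero form. -/
def SuperForm.zero : SuperForm 𝒱 where
  form := 0
  consistent := by simp
  superSymm := by simp

variable {𝒱} in
/-- The form `-(x, y)`. -/
def SuperForm.neg (B : SuperForm 𝒱) : SuperForm 𝒱 where
  form := -B.form
  consistent i j h x hx y hy := by simp [B.consistent i j h x hx y hy]
  superSymm i j x hx y hy := by simp [B.superSymm i j x hx y hy]

variable [DirectSum.Decomposition 𝒱]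

/-- The projection of `V` onto its homogeneous part of parity `i`. -/
def homProj (i : ZMod 2) : V →ₗ[ℂ] 𝒱 i :=
  DirectSum.component ℂ (ZMod 2) (fun i => 𝒱 i) i ∘ₗ
    (DirectSum.decomposeLinearEquiv 𝒱).toLinearMap

theorem homProj_same {i : ZMod 2} {x : V} (hx : x ∈ 𝒱 i) : (homProj 𝒱 i x : V) = x := by
  exact DirectSum.decompose_of_mem_same 𝒱 hx

theorem homProj_ne {i j : ZMod 2} {x : V} (hx : x ∈ 𝒱 i) (h : i ≠ j) :
    (homProj 𝒱 j x : V) = 0 := by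
  exact DirectSum.decompose_of_mem_ne 𝒱 hx h

theorem homProj_add (x : V) : (homProj 𝒱 0 x : V) + homProj 𝒱 1 x = x := by
  classical
  have h := DirectSum.sum_support_decompose 𝒱 x
  conv_rhs => rw [← h]
  rw [Finset.sum_subset (Finset.subset_univ _)]
  · rw [show (Finset.univ : Finset (ZMod 2)) = {0, 1} from rfl]
    rw [Finset.sum_pair (by decide)]
    rfl
  · intro i _ hi
    simpa using hi

/-- Linear maps on `V` are determined by their values on homogeneous vectors. -/
theorem hom_ext {W : Type*} [AddCommGroup W] [Module ℂ W] {f g : V →ₗ[ℂ] W}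
    (h : ∀ i, ∀ x ∈ 𝒱 i, f x = g x) : f = g := by
  ext x
  rw [← homProj_add 𝒱 x, map_add, map_add, h 0 _ (homProj 𝒱 0 x).2, h 1 _ (homProj 𝒱 1 x).2]

/-- The supertrace `str T = tr α - tr δ`, where `α : 𝒱 0 → 𝒱 0` and `δ : 𝒱 1 → 𝒱 1` are the
diagonal blocks of `T`. -/
def str (T : Module.End ℂ V) : ℂ :=
  LinearMap.trace ℂ (𝒱 0) (homProj 𝒱 0 ∘ₗ T ∘ₗ (𝒱 0).subtype) -
    LinearMap.trace ℂ (𝒱 1) (homProj 𝒱 1 ∘ₗ T ∘ₗ (𝒱 1).subtype)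

end Basic

/-! ## Lie superalgebras, enveloping algebras, Casimir elements -/

section LieSuper

variable {V : Type*} [AddCommGroup V] [Module ℂ V]

/-- A Lie superalgebra structure on the super vector space `V = 𝒱 0 ⊕ 𝒱 1`. -/
structure LieSuperalgebra (𝒱 : ZMod 2 → Submodule ℂ V) where
  /-- the bracket `[x, y]` -/
  bracket : V →ₗ[ℂ] V →ₗ[ℂ] V
  /-- `[𝒱 i, 𝒱 j] ⊆ 𝒱 (i + j)` -/
  graded : ∀ i j, ∀ x ∈ 𝒱 i, ∀ y ∈ 𝒱 j, bracket x y ∈ 𝒱 (i + j)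
  /-- skew super-symmetry -/
  skew : ∀ i j, ∀ x ∈ 𝒱 i, ∀ y ∈ 𝒱 j, bracket x y = -(sgn i j • bracket y x)
  /-- super Jacobi identity -/
  jacobi : ∀ i j, ∀ x ∈ 𝒱 i, ∀ y ∈ 𝒱 j, ∀ z,
    bracket x (bracket y z) = bracket (bracket x y) z + sgn i j • bracket y (bracket x z)

namespace LieSuperalgebra

variable {𝒱 : ZMod 2 → Submodule ℂ V} (L : LieSuperalgebra 𝒱)

/-- `L` is quadratic with respect to `B` if `B` is non-degenerate and invariant:
`([x, y], z) = (x, [y, z])`. -/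
structure IsQuadratic (B : SuperForm 𝒱) : Prop where
  nondegenerate : B.form.Nondegenerate
  invariant : ∀ x y z, B.form (L.bracket x y) z = B.form x (L.bracket y z)

/-- The relations `x ⊗ y = (-1)^{|x||y|} y ⊗ x + [x, y]` of the enveloping algebra. -/
inductive EnvRel : TensorAlgebra ℂ V → TensorAlgebra ℂ V → Prop
  | mk (i j : ZMod 2) (x y : V) (hx : x ∈ 𝒱 i) (hy : y ∈ 𝒱 j) :
      EnvRel (TensorAlgebra.ι ℂ x * TensorAlgebra.ι ℂ y)
        (sgn i j • (TensorAlgebra.ι ℂ y * TensorAlgebra.ι ℂ x) +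
          TensorAlgebra.ι ℂ (L.bracket x y))

/-- The universal enveloping algebra `U(𝔤)`. -/
def Env : Type _ := (ringConGen (EnvRel L)).Quotient

instance : Ring L.Env :=
  inferInstanceAs (Ring (RingCon.Quotient _))

instance : Algebra ℂ L.Env :=
  inferInstanceAs (Algebra ℂ (RingCon.Quotient _))

/-- The quotient map `T(𝔤) → U(𝔤)`. -/
def envMk : TensorAlgebra ℂ V →ₐ[ℂ] L.Env :=
  RingCon.mkₐ ℂ _

/-- The canonical map `𝔤 → U(𝔤)`. -/
def envι : V →ₗ[ℂ] L.Env :=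
  L.envMk.toLinearMap ∘ₗ TensorAlgebra.ι ℂ

/-- The extension `ad : U(𝔤) → End(𝔤)` of the adjoint representation `ad x (y) = [x, y]`. -/
def envAd : L.Env →ₐ[ℂ] Module.End ℂ V :=
  RingCon.liftₐ _ (TensorAlgebra.lift ℂ L.bracket) (RingCon.ringConGen_le.2 (by
    rintro _ _ ⟨i, j, x, y, hx, hy⟩
    change TensorAlgebra.lift ℂ L.bracket _ = TensorAlgebra.lift ℂ L.bracket _
    ext z
    simp [L.jacobi i j x hx y hy z, add_comm]))

theorem envAd_envι (x : V) : L.envAd (L.envι x) = L.bracket x := by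
  have h : L.envAd (L.envMk (TensorAlgebra.ι ℂ x)) =
      TensorAlgebra.lift ℂ L.bracket (TensorAlgebra.ι ℂ x) :=
    RingCon.liftₐ_mk _ _ _ _
  rw [TensorAlgebra.lift_ι_apply] at h
  exact h

/-- The Casimir element `∑ xᵢ xⁱ ∈ U(𝔤)`, computed from a basis `xᵢ` of `𝔤` and the dual basis
`xⁱ`, which is characterised by `(xⁱ, xⱼ) = δᵢⱼ`. -/
def casimir (B : SuperForm 𝒱) (hB : B.form.Nondegenerate) {n : ℕ}
    (b : Module.Basis (Fin n) ℂ V) : L.Env :=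
  ∑ i, L.envι (b i) * L.envι (B.form.dualBasis hB b i)

end LieSuperalgebra

end LieSuper

/-! ## Clifford and exterior algebras over a super vector space -/

section Clifford

variable {V : Type*} [AddCommGroup V] [Module ℂ V] {𝒱 : ZMod 2 → Submodule ℂ V}

/-- The relations `x ⊗ y + (-1)^{|x||y|} y ⊗ x = 2 (x, y)`. -/
inductive CliffRel (A : SuperForm 𝒱) : TensorAlgebra ℂ V → TensorAlgebra ℂ V → Prop
  | mk (i j : ZMod 2) (x y : V) (hx : x ∈ 𝒱 i) (hy : y ∈ 𝒱 j) :
      CliffRel A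
        (TensorAlgebra.ι ℂ x * TensorAlgebra.ι ℂ y +
          sgn i j • (TensorAlgebra.ι ℂ y * TensorAlgebra.ι ℂ x))
        (algebraMap ℂ _ (2 * A.form x y))

/-- The Clifford algebra `C(V)` of a super-symmetric form. -/
def Cliff (A : SuperForm 𝒱) : Type _ := (ringConGen (CliffRel A)).Quotient

instance (A : SuperForm 𝒱) : Ring (Cliff A) :=
  inferInstanceAs (Ring (RingCon.Quotient _))

instance (A : SuperForm 𝒱) : Algebra ℂ (Cliff A) :=
  inferInstanceAs (Algebra ℂ (RingCon.Quotient _))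

/-- The quotient map `T(V) → C(V)`. -/
def Cliff.mk (A : SuperForm 𝒱) : TensorAlgebra ℂ V →ₐ[ℂ] Cliff A :=
  RingCon.mkₐ ℂ _

variable (𝒱) in
/-- The exterior algebra `Λ(V)`: the case of the zero form, with relations
`x ∧ y + (-1)^{|x||y|} y ∧ x = 0`. -/
abbrev Ext : Type _ := Cliff (SuperForm.zero 𝒱)

/-- The canonical map `V → C(V)`. -/
def ζ (A : SuperForm 𝒱) : V →ₗ[ℂ] Cliff A :=
  (Cliff.mk A).toLinearMap ∘ₗ TensorAlgebra.ι ℂ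

theorem ζ_rel (A : SuperForm 𝒱) {i j : ZMod 2} {x y : V} (hx : x ∈ 𝒱 i) (hy : y ∈ 𝒱 j) :
    ζ A x * ζ A y + sgn i j • (ζ A y * ζ A x) = algebraMap ℂ _ (2 * A.form x y) := by
  have : Cliff.mk A _ = Cliff.mk A _ :=
    Quotient.sound (RingCon.le_ringConGen _ _ (CliffRel.mk (A := A) i j x y hx hy))
  simpa [ζ] using this

/-- Universal property of `C(V)`. -/
def Cliff.lift (A : SuperForm 𝒱) {R : Type*} [Ring R] [Algebra ℂ R] (f : V →ₗ[ℂ] R)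
    (hf : ∀ i j, ∀ x ∈ 𝒱 i, ∀ y ∈ 𝒱 j,
      f x * f y + sgn i j • (f y * f x) = algebraMap ℂ R (2 * A.form x y)) :
    Cliff A →ₐ[ℂ] R :=
  RingCon.liftₐ _ (TensorAlgebra.lift ℂ f) (RingCon.ringConGen_le.2 (by
    rintro _ _ ⟨i, j, x, y, hx, hy⟩
    change TensorAlgebra.lift ℂ f _ = TensorAlgebra.lift ℂ f _
    have := hf i j x hx y hy
    simpa using this))

@[simp] theorem Cliff.lift_ζ (A : SuperForm 𝒱) {R : Type*} [Ring R] [Algebra ℂ R]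
    (f : V →ₗ[ℂ] R) (hf) (x : V) : Cliff.lift A f hf (ζ A x) = f x := by
  have h : Cliff.lift A f hf (Cliff.mk A (TensorAlgebra.ι ℂ x)) =
      TensorAlgebra.lift ℂ f (TensorAlgebra.ι ℂ x) :=
    RingCon.liftₐ_mk _ _ _ _
  rw [TensorAlgebra.lift_ι_apply] at h
  exact h

theorem form_eq_zero_add (B : SuperForm 𝒱) : B.form = (SuperForm.zero 𝒱).form + B.form :=
  (zero_add B.form).symm

theorem zero_eq_form_add_neg (B : SuperForm 𝒱) : (SuperForm.zero 𝒱).form = B.form + B.neg.form :=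
  (add_neg_cancel B.form).symm

variable [DirectSum.Decomposition 𝒱]

theorem Cliff.submodule_eq_top (A : SuperForm 𝒱) (S : Submodule ℂ (Cliff A)) (h1 : 1 ∈ S)
    (hm : ∀ i, ∀ x ∈ 𝒱 i, ∀ u ∈ S, ζ A x * u ∈ S) (u : Cliff A) : u ∈ S := by
  have hm' : ∀ x, ∀ u ∈ S, ζ A x * u ∈ S := by
    intro x u hu
    rw [← homProj_add 𝒱 x, map_add, add_mul]
    exact S.add_mem (hm 0 _ (homProj 𝒱 0 x).2 u hu) (hm 1 _ (homProj 𝒱 1 x).2 u hu)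
  obtain ⟨t, rfl⟩ : ∃ t, Cliff.mk A t = u := RingCon.mkₐ_surjective (α := ℂ) _ u
  suffices H : ∀ v ∈ S, Cliff.mk A t * v ∈ S by
    simpa using H 1 h1
  induction t using TensorAlgebra.induction with
  | algebraMap r =>
    intro v hv
    rw [AlgHom.commutes, ← Algebra.smul_def]
    exact S.smul_mem r hv
  | ι x => intro v hv; exact hm' x v hv
  | mul a b ha hb =>
    intro v hv
    rw [map_mul, mul_assoc]
    exact ha _ (hb _ hv)
  | add a b ha hb =>
    intro v hv
    rw [map_add, add_mul]
    exact S.add_mem (ha _ hv) (hb _ hv)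

theorem Cliff.linear_ext {A : SuperForm 𝒱} {W : Type*} [AddCommGroup W] [Module ℂ W]
    {f g : Cliff A →ₗ[ℂ] W} (h1 : f 1 = g 1)
    (hm : ∀ i, ∀ x ∈ 𝒱 i, ∀ u, f u = g u → f (ζ A x * u) = g (ζ A x * u)) : f = g := by
  ext u
  exact Cliff.submodule_eq_top A (LinearMap.eqLocus f g) h1
    (fun i x hx u hu => hm i x hx u hu) u

/-! ### Contractions

For `z` homogeneous of parity `d`, the contraction `ι(z)` is the derivation of degree `(-1, d)`
with `ι(z) y = (z, y)`, i.e. `ι(z)(u v) = ι(z)(u) v + θ_d(u) ι(z)(v)` where `θ_d` is the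
automorphism with `θ_d(x) = -(-1)^{d|x|} x` for `x ∈ V`. It is read off from the algebra
homomorphism `u ↦ [[θ_d u, ι(z) u], [0, u]]`. -/

variable (𝒱) in
/-- The linear map `x ↦ -(-1)^{d|x|} x`. -/
def twist (d : ZMod 2) : V →ₗ[ℂ] V :=
  -((𝒱 0).subtype ∘ₗ homProj 𝒱 0) - sgn d 1 • ((𝒱 1).subtype ∘ₗ homProj 𝒱 1)

theorem twist_apply (d : ZMod 2) {i : ZMod 2} {x : V} (hx : x ∈ 𝒱 i) :
    twist 𝒱 d x = -(sgn d i • x) := by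
  rcases parity_cases i with rfl | rfl
  · have h1 : (homProj 𝒱 1 x : V) = 0 := homProj_ne 𝒱 hx (by decide)
    have h2 : sgn d 0 = 1 := by simp [sgn]
    simp [twist, homProj_same 𝒱 hx, h1, h2]
  · have h1 : (homProj 𝒱 0 x : V) = 0 := homProj_ne 𝒱 hx (by decide)
    simp [twist, homProj_same 𝒱 hx, h1]

/-- The linear map `x ↦ [[θ_d x, (z_d, x)], [0, x]]`, where `z_d` is the part of parity `d`. -/
def contrGen (A β : SuperForm 𝒱) (d : ZMod 2) (z : V) :
    V →ₗ[ℂ] Matrix (Fin 2) (Fin 2) (Cliff A) where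
  toFun x := !![ζ A (twist 𝒱 d x), algebraMap ℂ _ (β.form (homProj 𝒱 d z) x); 0, ζ A x]
  map_add' x y := by ext i j; fin_cases i <;> fin_cases j <;> simp
  map_smul' c x := by ext i j; fin_cases i <;> fin_cases j <;> simp [Algebra.smul_def]

theorem contrGen_rel (A β : SuperForm 𝒱) (d : ZMod 2) (z : V) (i j : ZMod 2) (x : V)
    (hx : x ∈ 𝒱 i) (y : V) (hy : y ∈ 𝒱 j) :
    contrGen A β d z x * contrGen A β d z y +
      sgn i j • (contrGen A β d z y * contrGen A β d z x) =
      algebraMap ℂ _ (2 * A.form x y) := by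
  have hrel := ζ_rel A hx hy
  have hz := (homProj 𝒱 d z).2
  ext k l
  fin_cases k <;> fin_cases l
  · simp only [contrGen, LinearMap.coe_mk, AddHom.coe_mk, twist_apply d hx, twist_apply d hy]
    have e : (sgn d i * sgn d j) • (algebraMap ℂ (Cliff A) (2 * A.form x y)) =
        algebraMap ℂ _ (2 * A.form x y) := by
      by_cases hij : i = j
      · subst hij; rw [sgn_mul_self, one_smul]
      · rw [A.consistent i j hij x hx y hy]; simp
    have : ((sgn d i * sgn d j) • (ζ A x * ζ A y + sgn i j • (ζ A y * ζ A x))) =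
        algebraMap ℂ _ (2 * A.form x y) := by rw [hrel, e]
    rw [smul_add] at this
    simp [Matrix.algebraMap_matrix_apply, -map_mul, ← this, smul_smul, mul_comm]
  · simp only [contrGen, LinearMap.coe_mk, AddHom.coe_mk, twist_apply d hx, twist_apply d hy]
    have ex : β.form (homProj 𝒱 d z) x * sgn d j = β.form (homProj 𝒱 d z) x * sgn i j := by
      by_cases h : d = i
      · rw [h]
      · rw [β.consistent d i h _ hz x hx]; simp
    have ey : β.form (homProj 𝒱 d z) y * sgn d i = β.form (homProj 𝒱 d z) y * sgn i j := by
      by_cases h : d = j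
      · rw [h, sgn_comm]
      · rw [β.consistent d j h _ hz y hy]; simp
    have c : ∀ (r : ℂ) (a : Cliff A), a * algebraMap ℂ _ r = r • a := fun r a => by
      rw [← Algebra.commutes, ← Algebra.smul_def]
    simp only [mul_comm _ (sgn _ _)] at ex ey
    simp [Matrix.algebraMap_matrix_apply, -map_mul, c, smul_smul, ex, ey]
    rw [← mul_assoc, sgn_mul_self, one_mul]
    abel
  · simp [contrGen, Matrix.algebraMap_matrix_apply]
  · simpa [contrGen, Matrix.algebraMap_matrix_apply] using hrel

/-- The homomorphism `u ↦ [[θ_d u, ι(z_d) u], [0, u]]`. -/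
def contrHom (A β : SuperForm 𝒱) (d : ZMod 2) (z : V) :
    Cliff A →ₐ[ℂ] Matrix (Fin 2) (Fin 2) (Cliff A) :=
  Cliff.lift A (contrGen A β d z) (contrGen_rel A β d z)

theorem contrHom_ζ_mul (A β : SuperForm 𝒱) (d : ZMod 2) (z : V) {i : ZMod 2} {x : V}
    (hx : x ∈ 𝒱 i) (u : Cliff A) (h : contrHom A β d z u 1 1 = u) :
    contrHom A β d z (ζ A x * u) 0 1 =
      β.form (homProj 𝒱 d z) x • u - sgn d i • (ζ A x * contrHom A β d z u 0 1) := by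
  have e : contrHom A β d z (ζ A x) = contrGen A β d z x := Cliff.lift_ζ _ _ _ _
  rw [map_mul, e, Matrix.mul_apply]
  simp [contrGen, twist_apply d hx, h, ← Algebra.smul_def, add_comm, sub_eq_add_neg]

theorem contrHom_one_one (A β : SuperForm 𝒱) (d : ZMod 2) (z : V) (u : Cliff A) :
    contrHom A β d z u 1 1 = u := by
  let f : Cliff A →ₗ[ℂ] Cliff A :=
    { toFun := fun u => contrHom A β d z u 1 1
      map_add' := by intros; simp
      map_smul' := by intros; simp }
  have : f = LinearMap.id := by
    apply Cliff.linear_ext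
    · simp [f]
    · intro i x hx u hu
      have hu' : contrHom A β d z u 1 1 = u := hu
      have e : contrHom A β d z (ζ A x) = contrGen A β d z x := Cliff.lift_ζ _ _ _ _
      simp [f, e, Matrix.mul_apply, contrGen, hu']
  exact LinearMap.congr_fun this u

theorem contrHom_one (A β : SuperForm 𝒱) (d : ZMod 2) (z : V) : contrHom A β d z 1 0 1 = 0 := by
  simp

/-- The contraction `ι(z_d)`, where `z_d` is the part of `z` of parity `d`. -/
def contrPart (A β : SuperForm 𝒱) (d : ZMod 2) : V →ₗ[ℂ] Module.End ℂ (Cliff A) where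
  toFun z :=
    { toFun := fun u => contrHom A β d z u 0 1
      map_add' := by intros; simp
      map_smul' := by intros; simp }
  map_add' z w := by
    apply Cliff.linear_ext
    · simp
    · intro i x hx u hu
      simp only [LinearMap.coe_mk, AddHom.coe_mk, LinearMap.add_apply] at hu ⊢
      simp only [contrHom_ζ_mul A β d _ hx u (contrHom_one_one ..), hu, map_add,
        Submodule.coe_add, LinearMap.add_apply, add_smul, mul_add, smul_add]
      abel
  map_smul' c z := by
    apply Cliff.linear_ext
    · simp
    · intro i x hx u hu
      simp only [LinearMap.coe_mk, AddHom.coe_mk, LinearMap.smul_apply, RingHom.id_apply] at hu ⊢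
      simp only [contrHom_ζ_mul A β d _ hx u (contrHom_one_one ..), hu, map_smul,
        Submodule.coe_smul, LinearMap.smul_apply, smul_eq_mul, mul_smul, smul_sub,
        mul_smul_comm, smul_comm c]

/-- The contraction `ι(z)` with respect to the form `β`, for arbitrary `z ∈ V`, acting on the
Clifford algebra of the form `A`. It is linear in `z`; for homogeneous `z` it is the derivation of
degree `(-1, |z|)` with `ι(z) y = (z, y)`, see `contr_one` and `contr_ζ_mul`. -/
def contr (A β : SuperForm 𝒱) : V →ₗ[ℂ] Module.End ℂ (Cliff A) :=
  contrPart A β 0 + contrPart A β 1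

theorem contr_one (A β : SuperForm 𝒱) (z : V) : contr A β z 1 = 0 := by
  simp [contr, contrPart]

theorem contr_eq (A β : SuperForm 𝒱) {d : ZMod 2} {z : V} (hz : z ∈ 𝒱 d) (u : Cliff A) :
    contr A β z u = contrHom A β d z u 0 1 := by
  have h0 : ∀ e, d ≠ e → contrPart A β e z = 0 := by
    intro e he
    have h : contrHom A β e z = contrHom A β e 0 := by
      have : contrGen A β e z = contrGen A β e 0 := by
        ext x : 1
        simp [contrGen, homProj_ne 𝒱 hz he]
      simp only [contrHom, this]
    calc contrPart A β e z = contrPart A β e 0 := by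
          ext u; change contrHom A β e z u 0 1 = contrHom A β e 0 u 0 1; rw [h]
      _ = 0 := map_zero _
  rcases parity_cases d with rfl | rfl
  · rw [contr, LinearMap.add_apply, h0 1 (by decide), add_zero]; rfl
  · rw [contr, LinearMap.add_apply, h0 0 (by decide), zero_add]; rfl

theorem contr_ζ_mul (A β : SuperForm 𝒱) {d i : ZMod 2} {z x : V} (hz : z ∈ 𝒱 d) (hx : x ∈ 𝒱 i)
    (u : Cliff A) :
    contr A β z (ζ A x * u) = β.form z x • u - sgn d i • (ζ A x * contr A β z u) := by
  rw [contr_eq A β hz, contr_eq A β hz, contrHom_ζ_mul A β d z hx u (contrHom_one_one ..),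
    homProj_same 𝒱 hz]

theorem contr_anticomm (A β β' : SuperForm 𝒱) {d e : ZMod 2} {z w : V} (hz : z ∈ 𝒱 d)
    (hw : w ∈ 𝒱 e) (u : Cliff A) :
    contr A β z (contr A β' w u) = -(sgn d e • contr A β' w (contr A β z u)) := by
  suffices h : contr A β z ∘ₗ contr A β' w = -(sgn d e • (contr A β' w ∘ₗ contr A β z)) from
    LinearMap.congr_fun h u
  apply Cliff.linear_ext
  · simp [contr_one]
  · intro i x hx u hu
    simp only [LinearMap.comp_apply, LinearMap.neg_apply, LinearMap.smul_apply] at hu ⊢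
    simp only [contr_ζ_mul A _ hz hx, contr_ζ_mul A _ hw hx, map_sub, map_smul, hu]
    have e1 : sgn d e * (sgn d i * β'.form w x) = β'.form w x := by
      by_cases h : e = i
      · rw [h, ← mul_assoc, sgn_mul_self, one_mul]
      · rw [β'.consistent e i h w hw x hx]; simp
    have e2 : sgn e i * β.form z x = sgn d e * β.form z x := by
      by_cases h : d = i
      · rw [h, sgn_comm]
      · rw [β.consistent d i h z hz x hx]; simp
    simp only [smul_sub, smul_smul, mul_neg, smul_neg, mul_smul_comm, e1, e2]
    module

/-! ### The action `γ` and the identification `η : C(V) ≃ Λ(V)` -/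

/-- The linear map `x ↦ ε(x) + ι(x)`, with `ε(x)` the left multiplication by `x` and `ι(x)` the
contraction with respect to `β`, both acting on the Clifford algebra of `A'`. -/
def actGen (A' β : SuperForm 𝒱) : V →ₗ[ℂ] Module.End ℂ (Cliff A') :=
  LinearMap.mul ℂ (Cliff A') ∘ₗ ζ A' + contr A' β

theorem actGen_apply (A' β : SuperForm 𝒱) (x : V) (u : Cliff A') :
    actGen A' β x u = ζ A' x * u + contr A' β x u := rfl

/-- If `A = A' + β`, the map `x ↦ ε(x) + ι(x)` extends to an action of the Clifford algebra of `A`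
on that of `A'`. -/
def act (A A' β : SuperForm 𝒱) (h : A.form = A'.form + β.form) :
    Cliff A →ₐ[ℂ] Module.End ℂ (Cliff A') :=
  Cliff.lift A (actGen A' β) (by
    intro i j x hx y hy
    ext u
    have h1 := congrArg (· * u) (ζ_rel A' hx hy)
    simp only [add_mul, smul_mul_assoc, mul_assoc, ← Algebra.smul_def] at h1
    have h2 : sgn i j * β.form y x = β.form x y := (β.superSymm i j x hx y hy).symm
    have h3 : contr A' β x (contr A' β y u) = -(sgn i j • contr A' β y (contr A' β x u)) :=
      contr_anticomm A' β β hx hy u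
    have h4 : algebraMap ℂ (Module.End ℂ (Cliff A')) (2 * A.form x y) u =
        (2 * A'.form x y) • u + (2 * β.form x y) • u := by
      rw [h, Module.algebraMap_end_apply, LinearMap.add_apply, LinearMap.add_apply]
      module
    rw [h4, ← h1]
    simp only [LinearMap.add_apply, LinearMap.smul_apply, Module.End.mul_apply, actGen_apply,
      map_add, contr_ζ_mul A' β hx hy, contr_ζ_mul A' β hy hx, h3, smul_add, smul_sub,
      smul_smul, h2, sgn_comm j i, sgn_mul_self]
    module)

/-- The map `u ↦ u · 1` given by the action of the Clifford algebra of `A` on that of `A'`. -/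
def change (A A' β : SuperForm 𝒱) (h : A.form = A'.form + β.form) : Cliff A →ₗ[ℂ] Cliff A' where
  toFun u := act A A' β h u 1
  map_add' := by intros; simp
  map_smul' := by intros; simp

theorem change_one (A A' β : SuperForm 𝒱) (h) : change A A' β h 1 = 1 := by
  simp [change]

theorem change_ζ_mul (A A' β : SuperForm 𝒱) (h) (x : V) (u : Cliff A) :
    change A A' β h (ζ A x * u) = ζ A' x * change A A' β h u + contr A' β x (change A A' β h u) := by
  have e : act A A' β h (ζ A x) = actGen A' β x := Cliff.lift_ζ _ _ _ _
  change act A A' β h (ζ A x * u) 1 = _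
  rw [map_mul, e, Module.End.mul_apply, actGen_apply]
  rfl

theorem change_contr (A A' β β' : SuperForm 𝒱) (h) {d : ZMod 2} {z : V} (hz : z ∈ 𝒱 d)
    (u : Cliff A) :
    change A A' β h (contr A β' z u) = contr A' β' z (change A A' β h u) := by
  suffices H : change A A' β h ∘ₗ contr A β' z = contr A' β' z ∘ₗ change A A' β h from
    LinearMap.congr_fun H u
  apply Cliff.linear_ext
  · simp [contr_one, change_one]
  · intro i x hx u hu
    simp only [LinearMap.comp_apply] at hu ⊢
    simp only [contr_ζ_mul _ _ hz hx, change_ζ_mul, map_sub, map_add, map_smul, hu,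
      contr_anticomm A' β' β hz hx]
    module

theorem contr_neg (A β : SuperForm 𝒱) {d : ZMod 2} {z : V} (hz : z ∈ 𝒱 d) (u : Cliff A) :
    contr A β.neg z u = -contr A β z u := by
  suffices H : contr A β.neg z = -contr A β z from LinearMap.congr_fun H u
  apply Cliff.linear_ext
  · simp [contr_one]
  · intro i x hx u hu
    simp only [LinearMap.neg_apply] at hu ⊢
    have : β.neg.form z x = -β.form z x := rfl
    simp only [contr_ζ_mul _ _ hz hx, hu, this]
    simp only [mul_neg]
    module

theorem change_change (A A' β : SuperForm 𝒱) (h : A.form = A'.form + β.form)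
    (h' : A'.form = A.form + β.neg.form) (u : Cliff A) :
    change A' A β.neg h' (change A A' β h u) = u := by
  suffices H : change A' A β.neg h' ∘ₗ change A A' β h = LinearMap.id from
    LinearMap.congr_fun H u
  apply Cliff.linear_ext
  · simp [change_one]
  · intro i x hx u hu
    simp only [LinearMap.comp_apply, LinearMap.id_apply] at hu ⊢
    simp only [change_ζ_mul, map_add, change_contr _ _ _ _ _ hx, hu, contr_neg _ _ hx]
    abel

theorem change_change' (A A' β : SuperForm 𝒱) (h : A.form = A'.form + β.form)
    (h' : A'.form = A.form + β.neg.form) (u : Cliff A') :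
    change A A' β h (change A' A β.neg h' u) = u := by
  suffices H : change A A' β h ∘ₗ change A' A β.neg h' = LinearMap.id from
    LinearMap.congr_fun H u
  apply Cliff.linear_ext
  · simp [change_one]
  · intro i x hx u hu
    simp only [LinearMap.comp_apply, LinearMap.id_apply] at hu ⊢
    simp only [change_ζ_mul, map_add, map_neg, change_contr _ _ _ _ _ hx, hu, contr_neg _ _ hx]
    abel

variable (B : SuperForm 𝒱)

/-- The contraction `ι(z)` on the exterior algebra `Λ(V)` with respect to the form `B`. -/
def extContr : V →ₗ[ℂ] Module.End ℂ (Ext 𝒱) := contr (SuperForm.zero 𝒱) B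

/-- The homomorphism `γ : C(V) → End Λ(V)` with `γ(x) = ε(x) + ι(x)` for `x ∈ V`. -/
def gamma : Cliff B →ₐ[ℂ] Module.End ℂ (Ext 𝒱) :=
  act B (SuperForm.zero 𝒱) B (form_eq_zero_add B)

theorem gamma_ζ (x : V) (u : Ext 𝒱) :
    gamma B (ζ B x) u = ζ (SuperForm.zero 𝒱) x * u + extContr B x u := by
  have e : gamma B (ζ B x) = actGen (SuperForm.zero 𝒱) B x := by
    rw [gamma, act, Cliff.lift_ζ]
  rw [e, actGen_apply]
  rfl

/-- The linear isomorphism `η : C(V) ≃ Λ(V)`, `η(u) = γ(u) 1`. -/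
def eta : Cliff B ≃ₗ[ℂ] Ext 𝒱 where
  toFun u := gamma B u 1
  map_add' := by intros; simp
  map_smul' := by intros; simp
  invFun := change (SuperForm.zero 𝒱) B B.neg (zero_eq_form_add_neg B)
  left_inv := change_change B (SuperForm.zero 𝒱) B (form_eq_zero_add B) (zero_eq_form_add_neg B)
  right_inv :=
    change_change' B (SuperForm.zero 𝒱) B (form_eq_zero_add B) (zero_eq_form_add_neg B)

theorem eta_apply (u : Cliff B) : eta B u = gamma B u 1 := rfl

/-- The Clifford multiplication on `Λ(V)`, transported from `C(V)` along `η`. -/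
def cliffMul (u v : Ext 𝒱) : Ext 𝒱 :=
  eta B ((eta B).symm u * (eta B).symm v)

/-- The space `Λ³(V)_0` of even cubic elements, spanned by the `x ∧ y ∧ z` with `x, y, z`
homogeneous and `|x| + |y| + |z| = 0`. -/
def evenCubic (𝒱 : ZMod 2 → Submodule ℂ V) : Submodule ℂ (Ext 𝒱) :=
  Submodule.span ℂ {u | ∃ i j k : ZMod 2, i + j + k = 0 ∧ ∃ x ∈ 𝒱 i, ∃ y ∈ 𝒱 j, ∃ z ∈ 𝒱 k,
    u = ζ (SuperForm.zero 𝒱) x * ζ (SuperForm.zero 𝒱) y * ζ (SuperForm.zero 𝒱) z}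

/-- The set of all `φ ∈ Λ³(V)_0` whose Clifford square is a scalar. -/
def cubicSet : Set (Ext 𝒱) :=
  {φ | φ ∈ evenCubic 𝒱 ∧ ∃ c : ℂ, cliffMul B φ φ = algebraMap ℂ (Ext 𝒱) c}

end Clifford

end SuperQuad

end

noncomputable section

namespace SuperQuad

section

variable {V : Type*} [AddCommGroup V] [Module ℂ V] {𝒱 : ZMod 2 → Submodule ℂ V}
  [DirectSum.Decomposition 𝒱]

/-! ### The automorphisms `θ_d` -/

/-! Write `φ` also for its image in C(V) under the inverse of `eta`. That inverse intertwines
contractions, and in C(V) the contraction by `z` is half the supercommutator with `z`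
(`two_smul_contr`). Put q(z) = ι(z)φ. Then [x,y] = 2ι(x)q(y), which up to skew symmetry is the
supercommutator of q(x) with y. Contracting φ² = c by y and then by x gives q([x,y]) = q(x)q(y) -
(-1)^{|x||y|} q(y)q(x) (`quadElt_cubicBracket`). So the bracket is the action on V ⊂ C(V) of
quadratic elements that close under supercommutators, and the Jacobi identity comes from
associativity of C(V). Grading, skew symmetry and invariance need only that φ is even and cubic and
that contractions supercommute up to sign.

For the constant, (x,[y,z]) is twice the scalar ι(x)ι(y)ι(z)φ, and this scalar is also the
degree-zero part of the Clifford product of x∧y∧z with φ (`extAug_gamma_cubic`). The Euler operator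
Σ ε(xᵢ)ι(xⁱ), used in degrees 2 and 3, gives 12φ = Σ xᵢ∧xⱼ∧[xʲ,xⁱ]. Hence 24φ² = Σ
(xᵢ,[xⱼ,[xʲ,xⁱ]]), and Σ (xᵢ, T xⁱ) is the supertrace of T (`str_eq_sum_form`). -/

/-- The automorphism `θ_d` of the Clifford algebra with `θ_d(x) = -(-1)^{d|x|} x` for `x ∈ V`. -/
def twistHom (A : SuperForm 𝒱) (d : ZMod 2) : Cliff A →ₐ[ℂ] Cliff A :=
  Cliff.lift A (ζ A ∘ₗ twist 𝒱 d) (by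
    intro i j x hx y hy
    -- The sign is harmless: it is a square when the parities agree, and otherwise (x,y) = 0.
    have e : (sgn d i * sgn d j) • (algebraMap ℂ (Cliff A) (2 * A.form x y)) =
        algebraMap ℂ _ (2 * A.form x y) := by
      by_cases hij : i = j
      · subst hij; rw [sgn_mul_self, one_smul]
      · rw [A.consistent i j hij x hx y hy]; simp
    rw [← e, ← ζ_rel A hx hy]
    simp [twist_apply d hx, twist_apply d hy, smul_smul, mul_comm])

theorem twistHom_ζ (A : SuperForm 𝒱) (d : ZMod 2) {i : ZMod 2} {x : V} (hx : x ∈ 𝒱 i) :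
    twistHom A d (ζ A x) = -(sgn d i • ζ A x) := by
  simp [twistHom, twist_apply d hx]

theorem twistHom_ζ' (A : SuperForm 𝒱) (d : ZMod 2) (x : V) :
    twistHom A d (ζ A x) = ζ A (twist 𝒱 d x) := by
  simp [twistHom]

/-- The twisted Leibniz rule for arbitrary products, which allows the equation φ² = c to be
differentiated. -/
theorem contr_mul (A β : SuperForm 𝒱) {d : ZMod 2} {z : V} (hz : z ∈ 𝒱 d) (u v : Cliff A) :
    contr A β z (u * v) = contr A β z u * v + twistHom A d u * contr A β z v := by
  suffices H : contr A β z ∘ₗ LinearMap.mulRight ℂ v =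
      LinearMap.mulRight ℂ v ∘ₗ contr A β z +
        LinearMap.mulRight ℂ (contr A β z v) ∘ₗ (twistHom A d).toLinearMap from
    LinearMap.congr_fun H u
  apply Cliff.linear_ext
  · simp [contr_one]
  · intro i x hx u hu
    simp only [LinearMap.comp_apply, LinearMap.add_apply, LinearMap.mulRight_apply,
      AlgHom.toLinearMap_apply] at hu ⊢
    simp only [mul_assoc, contr_ζ_mul A β hz hx, hu, map_mul, twistHom_ζ A d hx, mul_add, sub_mul,
      smul_mul_assoc, neg_mul]
    module

/-- Both sides are θ_d-twisted derivations in `u`, and on a generator they agree by the Clifford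
relation. This requires contracting with the very form that defines the algebra. -/
theorem two_smul_contr (A : SuperForm 𝒱) {d : ZMod 2} {z : V} (hz : z ∈ 𝒱 d) (u : Cliff A) :
    (2 : ℂ) • contr A A z u = ζ A z * u - twistHom A d u * ζ A z := by
  suffices H : (2 : ℂ) • contr A A z = LinearMap.mulLeft ℂ (ζ A z) -
      LinearMap.mulRight ℂ (ζ A z) ∘ₗ (twistHom A d).toLinearMap from
    LinearMap.congr_fun H u
  apply Cliff.linear_ext
  · simp [contr_one]
  · intro i x hx u hu
    simp only [LinearMap.comp_apply, LinearMap.sub_apply, LinearMap.mulRight_apply,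
      LinearMap.mulLeft_apply, LinearMap.smul_apply,
      AlgHom.toLinearMap_apply] at hu ⊢
    have h1 := congrArg (· * u) (ζ_rel A hz hx)
    simp only [add_mul, smul_mul_assoc, mul_assoc, ← Algebra.smul_def] at h1
    have h2 := congrArg (fun t => sgn d i • (ζ A x * t)) hu
    simp only [mul_sub, mul_smul_comm, smul_sub] at h2
    simp only [contr_ζ_mul A A hz hx, smul_sub, map_mul, twistHom_ζ A d hx, neg_mul,
      smul_mul_assoc, mul_assoc, smul_smul, ← h1] at h2 ⊢
    rw [mul_comm 2 (sgn d i), h2]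
    module

theorem twistHom_contr (A β : SuperForm 𝒱) (d : ZMod 2) {j : ZMod 2} {z : V} (hz : z ∈ 𝒱 j)
    (u : Cliff A) :
    twistHom A d (contr A β z u) = -(sgn d j • contr A β z (twistHom A d u)) := by
  suffices H : (twistHom A d).toLinearMap ∘ₗ contr A β z =
      -(sgn d j • (contr A β z ∘ₗ (twistHom A d).toLinearMap)) from
    LinearMap.congr_fun H u
  apply Cliff.linear_ext
  · simp [contr_one]
  · intro i x hx u hu
    simp only [LinearMap.comp_apply, LinearMap.neg_apply, LinearMap.smul_apply,
      AlgHom.toLinearMap_apply] at hu ⊢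
    have e : sgn d j * sgn d i * β.form z x = β.form z x := by
      by_cases h : j = i
      · rw [h, sgn_mul_self, one_mul]
      · rw [β.consistent j i h z hz x hx]; simp
    simp only [contr_ζ_mul A β hz hx, map_sub, map_smul, map_mul, twistHom_ζ A d hx, neg_mul,
      smul_mul_assoc, hu, mul_neg, mul_smul_comm, map_neg, smul_sub, smul_neg, smul_smul]
    linear_combination (norm := module) (-e) • twistHom A d u

theorem change_twistHom (A A' β : SuperForm 𝒱) (h) (d : ZMod 2) (u : Cliff A) :
    change A A' β h (twistHom A d u) = twistHom A' d (change A A' β h u) := by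
  suffices H : change A A' β h ∘ₗ (twistHom A d).toLinearMap =
      (twistHom A' d).toLinearMap ∘ₗ change A A' β h from
    LinearMap.congr_fun H u
  apply Cliff.linear_ext
  · simp [change_one]
  · intro i x hx u hu
    simp only [LinearMap.comp_apply, AlgHom.toLinearMap_apply] at hu ⊢
    simp only [change_ζ_mul, map_mul, map_add, twistHom_ζ _ d hx, neg_mul, smul_mul_assoc, map_neg,
      map_smul, hu, twistHom_contr _ _ d hx]
    module

/-! ### Transport of contractions and twists along `eta` -/

theorem eta_symm_contr (B : SuperForm 𝒱) {d : ZMod 2} {z : V} (hz : z ∈ 𝒱 d) (u : Ext 𝒱) :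
    (eta B).symm (extContr B z u) = contr B B z ((eta B).symm u) :=
  change_contr _ _ _ _ _ hz u

theorem eta_symm_twistHom (B : SuperForm 𝒱) (d : ZMod 2) (u : Ext 𝒱) :
    (eta B).symm (twistHom _ d u) = twistHom B d ((eta B).symm u) :=
  change_twistHom _ _ _ _ d u

theorem eta_symm_one (B : SuperForm 𝒱) : (eta B).symm 1 = 1 :=
  change_one _ _ _ _

theorem eta_symm_ζ_mul (B : SuperForm 𝒱) (x : V) (u : Ext 𝒱) :
    (eta B).symm (ζ _ x * u) = ζ B x * (eta B).symm u - (eta B).symm (extContr B x u) := by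
  have h (i : ZMod 2) (x : V) (hx : x ∈ 𝒱 i) :
      (eta B).symm (ζ _ x * u) = ζ B x * (eta B).symm u - (eta B).symm (extContr B x u) := by
    -- The inverse of `eta` is built from the form -B, so a generator acts through ε(x) - ι(x).
    rw [eta_symm_contr B hx, sub_eq_add_neg, ← contr_neg _ _ hx]
    exact change_ζ_mul _ _ _ _ x u
  rw [← homProj_add 𝒱 x]
  simp only [map_add, add_mul, LinearMap.add_apply, h _ _ (homProj 𝒱 0 x).2,
    h _ _ (homProj 𝒱 1 x).2]
  abel

theorem eta_symm_ζ (B : SuperForm 𝒱) (x : V) : (eta B).symm (ζ _ x) = ζ B x := by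
  have := eta_symm_ζ_mul B x 1
  simpa [eta_symm_one, extContr, contr_one] using this

/-! ### Augmentation and degrees -/

variable (𝒱) in
/-- The augmentation `Λ(V) → ℂ`. -/
def extAug : Ext 𝒱 →ₐ[ℂ] ℂ :=
  Cliff.lift _ 0 (by intros; simp [SuperForm.zero])

omit [DirectSum.Decomposition 𝒱] in
@[simp] theorem extAug_ζ (x : V) : extAug 𝒱 (ζ _ x) = 0 := by
  simp [extAug]

theorem extContr_ζ (B : SuperForm 𝒱) (z x : V) :
    extContr B z (ζ _ x) = algebraMap ℂ _ (B.form z x) := by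
  have h : (extContr B).flip (ζ _ x) = (Algebra.linearMap ℂ _) ∘ₗ B.form.flip x := by
    apply hom_ext 𝒱
    intro d z hz
    have h2 : (contr (SuperForm.zero 𝒱) B z) ∘ₗ ζ _ =
        (Algebra.linearMap ℂ (Ext 𝒱)) ∘ₗ B.form z := by
      apply hom_ext 𝒱
      intro i x hx
      have := contr_ζ_mul (SuperForm.zero 𝒱) B hz hx 1
      simpa [contr_one, ← Algebra.algebraMap_eq_smul_one] using this
    exact LinearMap.congr_fun h2 x
  exact LinearMap.congr_fun h z

theorem extAug_extContr_ζ (B : SuperForm 𝒱) (z x : V) :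
    extAug 𝒱 (extContr B z (ζ _ x)) = B.form z x := by
  rw [extContr_ζ, AlgHom.commutes]; rfl

/-- Contracting `ζ x` by z recovers the number (z,x), so non-degeneracy separates vectors already
inside Λ(V). -/
theorem ζ_ext_injective (B : SuperForm 𝒱) (hB : B.form.Nondegenerate) :
    Function.Injective (ζ (SuperForm.zero 𝒱)) := by
  rw [injective_iff_map_eq_zero]
  intro x hx
  refine hB.2 x fun z => ?_
  rw [← extAug_extContr_ζ, hx, map_zero, map_zero]

theorem ζ_injective (B : SuperForm 𝒱) (hB : B.form.Nondegenerate) :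
    Function.Injective (ζ B) := fun x y h => by
  rw [← eta_symm_ζ B x, ← eta_symm_ζ B y] at h
  exact ζ_ext_injective B hB ((eta B).symm.injective h)

variable (𝒱) in
/-- The homogeneous part `Λᵏ(V)` of the exterior algebra. -/
def extPow (k : ℕ) : Submodule ℂ (Ext 𝒱) := LinearMap.range (ζ (SuperForm.zero 𝒱)) ^ k

omit [DirectSum.Decomposition 𝒱] in
theorem ζ_mem_extPow (x : V) : ζ _ x ∈ extPow 𝒱 1 := by
  simp [extPow]

omit [DirectSum.Decomposition 𝒱] in
theorem mem_extPow_one {u : Ext 𝒱} : u ∈ extPow 𝒱 1 ↔ ∃ x, ζ _ x = u := by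
  simp [extPow]

omit [DirectSum.Decomposition 𝒱] in
theorem ζ_mul_mem_extPow {k : ℕ} (x : V) {u : Ext 𝒱} (hu : u ∈ extPow 𝒱 k) :
    ζ _ x * u ∈ extPow 𝒱 (k + 1) := by
  rw [extPow, pow_succ']
  exact Submodule.mul_mem_mul ⟨x, rfl⟩ hu

/-- `Λᵏ⁺¹(V)` is spanned by the `x ∧ u` with `x` homogeneous and `u ∈ Λᵏ(V)`. -/
theorem extPow_succ_le {k : ℕ} {S : Submodule ℂ (Ext 𝒱)}
    (h : ∀ i, ∀ x ∈ 𝒱 i, ∀ u ∈ extPow 𝒱 k, ζ _ x * u ∈ S) : extPow 𝒱 (k + 1) ≤ S := by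
  rw [extPow, pow_succ', Submodule.mul_le]
  rintro _ ⟨x, rfl⟩ u hu
  rw [← homProj_add 𝒱 x, map_add, add_mul]
  exact S.add_mem (h _ _ (homProj 𝒱 0 x).2 u hu) (h _ _ (homProj 𝒱 1 x).2 u hu)

theorem extAug_eq_zero {k : ℕ} {u : Ext 𝒱} (hu : u ∈ extPow 𝒱 (k + 1)) : extAug 𝒱 u = 0 := by
  refine extPow_succ_le (S := LinearMap.ker (extAug 𝒱).toLinearMap) ?_ hu
  intro i x _ u _
  simp

theorem extContr_eq_zero (B : SuperForm 𝒱) (z : V) {u : Ext 𝒱} (hu : u ∈ extPow 𝒱 0) :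
    extContr B z u = 0 := by
  rw [extPow, pow_zero] at hu
  obtain ⟨c, rfl⟩ := Submodule.mem_one.1 hu
  rw [Algebra.algebraMap_eq_smul_one, map_smul, extContr, contr_one, smul_zero]

theorem extContr_mem_extPow (B : SuperForm 𝒱) (z : V) {k : ℕ} {u : Ext 𝒱}
    (hu : u ∈ extPow 𝒱 (k + 1)) : extContr B z u ∈ extPow 𝒱 k := by
  have key (d : ZMod 2) (z : V) (hz : z ∈ 𝒱 d) (k : ℕ) (u : Ext 𝒱)
      (hu : u ∈ extPow 𝒱 (k + 1)) : extContr B z u ∈ extPow 𝒱 k := by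
    induction k generalizing u with
    | zero =>
      refine extPow_succ_le (S := (extPow 𝒱 0).comap (extContr B z)) ?_ hu
      intro i x hx u hu
      have h0 : contr (SuperForm.zero 𝒱) B z u = 0 := extContr_eq_zero B z hu
      rw [Submodule.mem_comap, extContr, contr_ζ_mul _ _ hz hx, h0, mul_zero, smul_zero, sub_zero]
      exact Submodule.smul_mem _ _ hu
    | succ k ih =>
      refine extPow_succ_le (S := (extPow 𝒱 (k + 1)).comap (extContr B z)) ?_ hu
      intro i x hx u hu
      rw [Submodule.mem_comap, extContr, contr_ζ_mul _ _ hz hx]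
      exact Submodule.sub_mem _ (Submodule.smul_mem _ _ hu)
        (Submodule.smul_mem _ _ (ζ_mul_mem_extPow x (ih u hu)))
  rw [← homProj_add 𝒱 z, map_add, LinearMap.add_apply]
  exact Submodule.add_mem _ (key _ _ (homProj 𝒱 0 z).2 k u hu) (key _ _ (homProj 𝒱 1 z).2 k u hu)

omit [DirectSum.Decomposition 𝒱] in
theorem evenCubic_le_extPow : evenCubic 𝒱 ≤ extPow 𝒱 3 := by
  rw [evenCubic, Submodule.span_le]
  rintro _ ⟨i, j, k, -, x, -, y, -, z, -, rfl⟩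
  rw [mul_assoc]
  exact ζ_mul_mem_extPow x (ζ_mul_mem_extPow y (ζ_mem_extPow z))

/-- Degree three contributes three minus signs, and the parity signs multiply to the sign of the
total parity, which is even. -/
theorem twistHom_of_mem_evenCubic (d : ZMod 2) {φ : Ext 𝒱} (hφ : φ ∈ evenCubic 𝒱) :
    twistHom _ d φ = -φ := by
  have h : evenCubic 𝒱 ≤ LinearMap.eqLocus (twistHom (SuperForm.zero 𝒱) d).toLinearMap
      (-LinearMap.id) := by
    rw [evenCubic, Submodule.span_le]
    rintro _ ⟨i, j, k, h, x, hx, y, hy, z, hz, rfl⟩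
    have hs : sgn d i * sgn d j * sgn d k = 1 := by
      rw [← sgn_add_right, ← sgn_add_right, h]; simp [sgn]
    simp only [SetLike.mem_coe, LinearMap.mem_eqLocus, AlgHom.toLinearMap_apply, map_mul,
      twistHom_ζ _ d hx, twistHom_ζ _ d hy, twistHom_ζ _ d hz, LinearMap.neg_apply,
      LinearMap.id_apply, neg_mul, mul_neg, smul_mul_assoc, mul_smul_comm]
    linear_combination (norm := module) (-hs) • (ζ _ x * ζ _ y * ζ _ z)
  exact h hφ

/-! ### Dual bases and the supertrace -/

section DualBasis

variable {B : SuperForm 𝒱} {hB : B.form.Nondegenerate} {n : ℕ} (b : Module.Basis (Fin n) ℂ V)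

omit [DirectSum.Decomposition 𝒱] in
theorem sum_form_smul_dualBasis (v : V) :
    ∑ i, B.form v (b i) • B.form.dualBasis hB b i = v := by
  conv_rhs => rw [← (B.form.dualBasis hB b).sum_repr v]
  simp

omit [DirectSum.Decomposition 𝒱] in
theorem sum_form_dualBasis_smul (v : V) :
    ∑ i, B.form (B.form.dualBasis hB b i) v • b i = v := by
  conv_rhs => rw [← b.sum_repr v]
  refine Finset.sum_congr rfl fun i _ => ?_
  congr 1
  rw [congrArg (B.form _) (b.sum_repr v).symm, map_sum]
  simp [LinearMap.BilinForm.apply_dualBasis_left]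

omit [DirectSum.Decomposition 𝒱] in
/-- An operator may be moved to its adjoint in the sum over a basis and its dual basis. -/
theorem sum_adjoint {W : Type*} [AddCommGroup W] [Module ℂ W] (f : V →ₗ[ℂ] V →ₗ[ℂ] W)
    (S T : V →ₗ[ℂ] V) (h : ∀ x y, B.form (S x) y = B.form x (T y)) :
    ∑ i, f (b i) (S (B.form.dualBasis hB b i)) = ∑ i, f (T (b i)) (B.form.dualBasis hB b i) := by
  have h1 (i : Fin n) : f (b i) (S (B.form.dualBasis hB b i)) =
      ∑ j, B.form (B.form.dualBasis hB b i) (T (b j)) • f (b i) (B.form.dualBasis hB b j) := by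
    conv_lhs => rw [← sum_form_smul_dualBasis (hB := hB) b (S (B.form.dualBasis hB b i))]
    simp [h]
  have h2 (j : Fin n) : f (T (b j)) (B.form.dualBasis hB b j) =
      ∑ i, B.form (B.form.dualBasis hB b i) (T (b j)) • f (b i) (B.form.dualBasis hB b j) := by
    conv_lhs => rw [← sum_form_dualBasis_smul (hB := hB) b (T (b j))]
    simp
  simp only [h1, h2]
  exact Finset.sum_comm

/-- The form is symmetric on the even part and antisymmetric on the odd part. This sign is what
turns a trace into a supertrace. -/
theorem form_homProj (B : SuperForm 𝒱) (x y : V) :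
    B.form (homProj 𝒱 0 x) y - B.form (homProj 𝒱 1 x) y = B.form y x := by
  have h (i j : ZMod 2) (hij : i ≠ j) (x y : V) : B.form (homProj 𝒱 i x) (homProj 𝒱 j y) = 0 :=
    B.consistent i j hij _ (homProj 𝒱 i x).2 _ (homProj 𝒱 j y).2
  have h0 := B.superSymm 0 0 _ (homProj 𝒱 0 x).2 _ (homProj 𝒱 0 y).2
  have h1 := B.superSymm 1 1 _ (homProj 𝒱 1 x).2 _ (homProj 𝒱 1 y).2
  simp only [sgn, zero_ne_one, and_self, if_true, if_false] at h0 h1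
  conv_lhs => rw [← homProj_add 𝒱 y]
  conv_rhs => rw [← homProj_add 𝒱 y, ← homProj_add 𝒱 x]
  simp [h 0 1, h 1 0, h0, h1]

omit [DirectSum.Decomposition 𝒱] in
include hB in
theorem trace_eq_sum_form (T : Module.End ℂ V) :
    LinearMap.trace ℂ V T = ∑ i, B.form (T (B.form.dualBasis hB b i)) (b i) := by
  rw [LinearMap.trace_eq_matrix_trace ℂ (B.form.dualBasis hB b), Matrix.trace]
  simp [LinearMap.toMatrix_apply]

theorem trace_block [FiniteDimensional ℂ V] (i : ZMod 2) (T : Module.End ℂ V) :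
    LinearMap.trace ℂ (𝒱 i) (homProj 𝒱 i ∘ₗ T ∘ₗ (𝒱 i).subtype) =
      LinearMap.trace ℂ V ((𝒱 i).subtype ∘ₗ homProj 𝒱 i ∘ₗ T) := by
  rw [← LinearMap.comp_assoc, LinearMap.trace_comp_comm']

/-- The coordinates of a vector in the dual basis are its pairings with `b i`; `form_homProj` then
absorbs the parity sign. The basis need not be homogeneous. -/
theorem str_eq_sum_form [FiniteDimensional ℂ V] (T : Module.End ℂ V) :
    str 𝒱 T = ∑ i, B.form (b i) (T (B.form.dualBasis hB b i)) := by
  rw [str, trace_block, trace_block, trace_eq_sum_form (hB := hB) b,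
    trace_eq_sum_form (hB := hB) b, ← Finset.sum_sub_distrib]
  exact Finset.sum_congr rfl fun i _ => form_homProj B _ _

end DualBasis

/-! ### The Euler operator -/

theorem twist_twist (d : ZMod 2) (x : V) : twist 𝒱 d (twist 𝒱 d x) = x := by
  have : twist 𝒱 d ∘ₗ twist 𝒱 d = LinearMap.id := by
    apply hom_ext 𝒱
    intro i x hx
    simp [twist_apply d hx, smul_smul, sgn_mul_self]
  exact LinearMap.congr_fun this x

theorem form_twist (B : SuperForm 𝒱) (d : ZMod 2) (x y : V) :
    B.form (twist 𝒱 d x) y = B.form x (twist 𝒱 d y) := by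
  have : B.form ∘ₗ twist 𝒱 d = B.form.compl₂ (twist 𝒱 d) := by
    apply hom_ext 𝒱
    intro i x hx
    apply hom_ext 𝒱
    intro j y hy
    by_cases hij : i = j
    · subst hij; simp [twist_apply d hx, twist_apply d hy]
    · simp [twist_apply d hx, twist_apply d hy, B.consistent i j hij x hx y hy]
  exact LinearMap.congr_fun₂ this x y

/-- Expressing the sign through `twist` makes the exchange rule linear in z, so it applies to basis
vectors of mixed parity. -/
theorem ζ_mul_ζ (z : V) {i : ZMod 2} {x : V} (hx : x ∈ 𝒱 i) :
    ζ (SuperForm.zero 𝒱) z * ζ _ x = ζ _ x * ζ _ (twist 𝒱 i z) := by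
  have : LinearMap.mulRight ℂ (ζ _ x) ∘ₗ ζ (SuperForm.zero 𝒱) =
      LinearMap.mulLeft ℂ (ζ _ x) ∘ₗ ζ _ ∘ₗ twist 𝒱 i := by
    apply hom_ext 𝒱
    intro j z hz
    have h := ζ_rel (SuperForm.zero 𝒱) hz hx
    have h0 : (SuperForm.zero 𝒱).form z x = 0 := rfl
    rw [h0, mul_zero, map_zero] at h
    simpa [twist_apply i hz, sgn_comm i j] using eq_neg_of_add_eq_zero_left h
  exact LinearMap.congr_fun this z

theorem extContr_ζ_mul (B : SuperForm 𝒱) (z : V) {i : ZMod 2} {x : V} (hx : x ∈ 𝒱 i)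
    (u : Ext 𝒱) :
    extContr B z (ζ _ x * u) = B.form z x • u + ζ _ x * extContr B (twist 𝒱 i z) u := by
  have : (extContr B).flip (ζ _ x * u) = (B.form.flip x).smulRight u +
      LinearMap.mulLeft ℂ (ζ _ x) ∘ₗ (extContr B).flip u ∘ₗ twist 𝒱 i := by
    apply hom_ext 𝒱
    intro j z hz
    have := contr_ζ_mul (SuperForm.zero 𝒱) B hz hx u
    simpa [twist_apply i hz, sgn_comm i j, extContr, sub_eq_add_neg] using this
  exact LinearMap.congr_fun this z

/-- The operator `∑ ε(xᵢ) ι(xⁱ)` acts on `Λᵏ(V)` as multiplication by `k`. -/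
theorem sum_ζ_mul_extContr {B : SuperForm 𝒱} {hB : B.form.Nondegenerate} {n : ℕ}
    (b : Module.Basis (Fin n) ℂ V) {k : ℕ} {u : Ext 𝒱} (hu : u ∈ extPow 𝒱 k) :
    ∑ i, ζ _ (b i) * extContr B (B.form.dualBasis hB b i) u = (k : ℂ) • u := by
  induction k generalizing u with
  | zero => simp [extContr_eq_zero B _ hu]
  | succ k ih =>
    refine extPow_succ_le (S := LinearMap.eqLocus
      (∑ i, LinearMap.mulLeft ℂ (ζ _ (b i)) ∘ₗ extContr B (B.form.dualBasis hB b i))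
      (((k + 1 : ℕ) : ℂ) • LinearMap.id)) ?_ hu |> fun h => by
        simpa only [LinearMap.mem_eqLocus, LinearMap.sum_apply, LinearMap.comp_apply,
          LinearMap.mulLeft_apply, LinearMap.smul_apply, LinearMap.id_apply] using h
    intro p x hx u hu
    have h1 : ∑ i, ζ _ (b i) * extContr B (twist 𝒱 p (B.form.dualBasis hB b i)) u =
        ∑ i, ζ _ (twist 𝒱 p (b i)) * extContr B (B.form.dualBasis hB b i) u :=
      sum_adjoint b (((LinearMap.mul ℂ (Ext 𝒱)).compl₂ ((extContr B).flip u)) ∘ₗ ζ _) _ _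
        (form_twist B p)
    -- `twist` is self-adjoint and an involution, so applying it to both factors preserves Σ xᵢ ⊗
    -- xⁱ.
    have h2 : ∑ i, ζ _ (twist 𝒱 p (b i)) *
        extContr B (twist 𝒱 p (B.form.dualBasis hB b i)) u =
        ∑ i, ζ _ (b i) * extContr B (B.form.dualBasis hB b i) u := by
      have := sum_adjoint (hB := hB) b (((LinearMap.mul ℂ (Ext 𝒱)).compl₂ ((extContr B).flip u)) ∘ₗ
        ζ _ ∘ₗ twist 𝒱 p) _ _ (form_twist B p)
      simpa [twist_twist] using this
    -- The contraction of the leading factor x restores x∧u once: this raises the eigenvalue from k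
    -- to k + 1.
    have h3 : ∑ i, B.form (B.form.dualBasis hB b i) x • (ζ (SuperForm.zero 𝒱) (b i) * u) =
        ζ _ x * u := by
      conv_rhs => rw [← sum_form_dualBasis_smul (hB := hB) b x, map_sum, Finset.sum_mul]
      simp
    have h4 : ∑ i, ζ _ x * (ζ _ (twist 𝒱 p (b i)) *
        extContr B (twist 𝒱 p (B.form.dualBasis hB b i)) u) = (k : ℂ) • (ζ _ x * u) := by
      rw [← Finset.mul_sum, h2, ih hu, mul_smul_comm]
    simp only [LinearMap.mem_eqLocus, LinearMap.sum_apply, LinearMap.comp_apply,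
      LinearMap.mulLeft_apply, extContr_ζ_mul B _ hx, mul_add, mul_smul_comm,
      Finset.sum_add_distrib, h3, ← mul_assoc, ζ_mul_ζ _ hx]
    simp only [mul_assoc, h4]
    rw [LinearMap.smul_apply, LinearMap.id_apply, Nat.cast_succ, add_smul, one_smul, add_comm]

/-! ### The scalar part of a Clifford product -/

/-- `⟨ψ φ⟩₀` for `ψ = x ∧ y ∧ z` and `φ` cubic is the full contraction. -/
theorem extAug_gamma_cubic (B : SuperForm 𝒱) (x y z : V) {φ : Ext 𝒱} (hφ : φ ∈ extPow 𝒱 3) :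
    extAug 𝒱 (gamma B ((eta B).symm (ζ _ x * (ζ _ y * ζ _ z))) φ) =
      extAug 𝒱 (extContr B x (extContr B y (extContr B z φ))) := by
  have h1 (z : V) : extContr B z φ ∈ extPow 𝒱 2 := extContr_mem_extPow B z hφ
  have h2 (y z : V) : extContr B y (extContr B z φ) ∈ extPow 𝒱 1 := extContr_mem_extPow B y (h1 z)
  have h3 (y z : V) : ζ _ y * extContr B z φ ∈ extPow 𝒱 3 := ζ_mul_mem_extPow y (h1 z)
  have h4 (z : V) : ζ _ z * φ ∈ extPow 𝒱 4 := ζ_mul_mem_extPow z hφ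
  have h5 (y z : V) : ζ _ y * (ζ _ z * φ) ∈ extPow 𝒱 5 := ζ_mul_mem_extPow y (h4 z)
  -- Passing from x∧y∧z to the Clifford product xyz costs only degree-one corrections, and a vector
  -- acting on a cubic element lands in degrees 2 and 4, with no scalar part.
  obtain ⟨v, hv⟩ := mem_extPow_one.1 (extContr_mem_extPow B x
    (ζ_mul_mem_extPow y (ζ_mem_extPow z)))
  rw [eta_symm_ζ_mul, eta_symm_ζ_mul, ← hv, extContr_ζ, eta_symm_ζ, eta_symm_ζ,
    Algebra.algebraMap_eq_smul_one, map_smul, eta_symm_one]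
  -- Three generators acting on degree 3 reach degree 0 only when each of them contracts.
  simp only [map_sub, map_mul, map_smul, map_one, LinearMap.sub_apply, Module.End.mul_apply,
    LinearMap.smul_apply, Module.End.one_apply, gamma_ζ, map_add, extAug_ζ, zero_mul,
    extAug_eq_zero (h1 _),
    extAug_eq_zero (extContr_mem_extPow B x (h5 y z)),
    extAug_eq_zero (extContr_mem_extPow B x (h3 y z)),
    extAug_eq_zero (extContr_mem_extPow B x (extContr_mem_extPow B y (h4 z)))]
  simp

/-! ### The bracket of an even cubic element: grading, skew symmetry, invariance -/

/-- θ_1 is -1 on even vectors and +1 on odd ones, so its eigenvalue detects parity. -/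
theorem mem_of_twist {i : ZMod 2} {v : V} (h : twist 𝒱 1 v = -(sgn 1 i • v)) : v ∈ 𝒱 i := by
  have hd := homProj_add 𝒱 v
  have ht : twist 𝒱 1 v = -(homProj 𝒱 0 v : V) + homProj 𝒱 1 v := by
    simp [twist, sgn]
  rw [ht] at h
  have h2 : (2 : ℂ) ≠ 0 := two_ne_zero
  rcases parity_cases i with rfl | rfl
  · have : (homProj 𝒱 1 v : V) = 0 := by
      have e : (2 : ℂ) • (homProj 𝒱 1 v : V) = 0 := by
        simp only [sgn] at h
        simp at h
        linear_combination (norm := module) h + hd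
      simpa using e
    rw [← hd, this, add_zero]
    exact (homProj 𝒱 0 v).2
  · have : (homProj 𝒱 0 v : V) = 0 := by
      have e : (2 : ℂ) • (homProj 𝒱 0 v : V) = 0 := by
        simp only [sgn] at h
        simp at h
        linear_combination (norm := module) -h + hd
      simpa using e
    rw [← hd, this, zero_add]
    exact (homProj 𝒱 1 v).2

section Bracket

variable (B : SuperForm 𝒱) (hB : B.form.Nondegenerate) (φ : Ext 𝒱)

/-- The bracket `[x, y]` with `[x, y] = 2 ι(x) ι(y) φ` in `Λ(V)`. -/
def cubicBracket : V →ₗ[ℂ] V →ₗ[ℂ] V :=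
  ((2 : ℂ) • ((LinearMap.mul ℂ (Module.End ℂ (Ext 𝒱))).compl₁₂ (extContr B) (extContr B))).compr₂
    ((LinearMap.exists_leftInverse_of_injective (ζ (SuperForm.zero 𝒱))
      (LinearMap.ker_eq_bot.2 (ζ_ext_injective B hB))).choose ∘ₗ LinearMap.applyₗ φ)

variable {φ}

/-- Two contractions bring a cubic element down to Λ¹, the image of `ζ`, so the choice of left
inverse in `cubicBracket` is immaterial. -/
theorem ζ_cubicBracket (hφ : φ ∈ evenCubic 𝒱) (x y : V) :
    ζ _ (cubicBracket B hB φ x y) = (2 : ℂ) • extContr B x (extContr B y φ) := by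
  have hr := (LinearMap.exists_leftInverse_of_injective (ζ (SuperForm.zero 𝒱))
      (LinearMap.ker_eq_bot.2 (ζ_ext_injective B hB))).choose_spec
  obtain ⟨v, hv⟩ := mem_extPow_one.1 (Submodule.smul_mem _ (2 : ℂ) (extContr_mem_extPow B x
    (extContr_mem_extPow B y (evenCubic_le_extPow hφ))))
  have : cubicBracket B hB φ x y = v := by
    rw [← LinearMap.id_apply (R := ℂ) v, ← hr, LinearMap.comp_apply, hv]
    rfl
  rw [this, hv]

theorem form_cubicBracket (hφ : φ ∈ evenCubic 𝒱) (x y z : V) :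
    B.form x (cubicBracket B hB φ y z) =
      2 * extAug 𝒱 (extContr B x (extContr B y (extContr B z φ))) := by
  rw [← extAug_extContr_ζ, ζ_cubicBracket B hB hφ, map_smul, map_smul, smul_eq_mul]

theorem extContr_anticomm {i j : ZMod 2} {x y : V} (hx : x ∈ 𝒱 i) (hy : y ∈ 𝒱 j) (u : Ext 𝒱) :
    extContr B x (extContr B y u) = -(sgn i j • extContr B y (extContr B x u)) :=
  contr_anticomm _ B B hx hy u

theorem cubicBracket_skew (hφ : φ ∈ evenCubic 𝒱) {i j : ZMod 2} {x y : V} (hx : x ∈ 𝒱 i)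
    (hy : y ∈ 𝒱 j) :
    cubicBracket B hB φ x y = -(sgn i j • cubicBracket B hB φ y x) := by
  apply ζ_ext_injective B hB
  rw [map_neg, map_smul, ζ_cubicBracket B hB hφ, ζ_cubicBracket B hB hφ,
    extContr_anticomm B hx hy]
  module

theorem cubicBracket_mem (hφ : φ ∈ evenCubic 𝒱) {i j : ZMod 2} {x y : V} (hx : x ∈ 𝒱 i)
    (hy : y ∈ 𝒱 j) : cubicBracket B hB φ x y ∈ 𝒱 (i + j) := by
  apply mem_of_twist
  apply ζ_ext_injective B hB
  rw [← twistHom_ζ', map_neg, map_smul, ζ_cubicBracket B hB hφ, map_smul, extContr,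
    twistHom_contr _ _ _ hx, twistHom_contr _ _ _ hy, twistHom_of_mem_evenCubic _ hφ,
    sgn_add_right]
  simp only [map_neg, map_smul]
  module

theorem cubicBracket_invariant (hφ : φ ∈ evenCubic 𝒱) (x y z : V) :
    B.form (cubicBracket B hB φ x y) z = B.form x (cubicBracket B hB φ y z) := by
  suffices h : B.form.flip z ∘ₗ (cubicBracket B hB φ).flip y =
      B.form.flip (cubicBracket B hB φ y z) from LinearMap.congr_fun h x
  apply hom_ext 𝒱
  intro i x hx
  suffices h : B.form.flip z ∘ₗ cubicBracket B hB φ x =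
      B.form x ∘ₗ (cubicBracket B hB φ).flip z from LinearMap.congr_fun h y
  apply hom_ext 𝒱
  intro j y hy
  suffices h : B.form (cubicBracket B hB φ x y) = B.form x ∘ₗ cubicBracket B hB φ y from
    LinearMap.congr_fun h z
  apply hom_ext 𝒱
  intro k z hz
  rw [LinearMap.comp_apply]
  -- Moving z from the first to the last contraction takes two exchanges; their minus signs cancel,
  -- and their parity signs cancel the one from super-symmetry of the form.
  rw [B.superSymm (i + j) k _ (cubicBracket_mem B hB hφ hx hy) z hz, form_cubicBracket B hB hφ,
    form_cubicBracket B hB hφ, extContr_anticomm B hz hx, extContr_anticomm B hz hy,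
    sgn_comm (i + j), sgn_add_right]
  simp only [map_neg, map_smul, smul_neg, neg_neg, smul_smul, smul_eq_mul]
  linear_combination (2 * extAug 𝒱 (extContr B x (extContr B y (extContr B z φ)))) *
    (sgn k j * sgn k j * sgn_mul_self k i + sgn_mul_self k j)

/-! ### The Jacobi identity -/

variable (φ) in
/-- The quadratic element `ι(z) φ` of the Clifford algebra. -/
def quadElt : V →ₗ[ℂ] Cliff B := (contr B B).flip ((eta B).symm φ)

theorem twistHom_eta_symm (hφ : φ ∈ evenCubic 𝒱) (d : ZMod 2) :
    twistHom B d ((eta B).symm φ) = -(eta B).symm φ := by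
  rw [← eta_symm_twistHom, twistHom_of_mem_evenCubic d hφ, map_neg]

theorem twistHom_quadElt (hφ : φ ∈ evenCubic 𝒱) (d : ZMod 2) {j : ZMod 2} {z : V}
    (hz : z ∈ 𝒱 j) : twistHom B d (quadElt B φ z) = sgn d j • quadElt B φ z := by
  rw [quadElt, LinearMap.flip_apply, twistHom_contr _ _ _ hz, twistHom_eta_symm B hφ, map_neg,
    smul_neg, neg_neg]

theorem two_smul_contr_quadElt (hφ : φ ∈ evenCubic 𝒱) {i j : ZMod 2} {x y : V} (hx : x ∈ 𝒱 i)
    (hy : y ∈ 𝒱 j) :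
    (2 : ℂ) • contr B B x (quadElt B φ y) = ζ B (cubicBracket B hB φ x y) := by
  rw [← eta_symm_ζ, ζ_cubicBracket B hB hφ, map_smul, eta_symm_contr B hx, eta_symm_contr B hy]
  rfl

/-- Skew symmetry first rewrites the bracket as a contraction by y, so that `two_smul_contr` puts
q(x) in the role of the acting element. -/
theorem ζ_cubicBracket_eq_commutator (hφ : φ ∈ evenCubic 𝒱) {i j : ZMod 2} {x y : V}
    (hx : x ∈ 𝒱 i) (hy : y ∈ 𝒱 j) :
    ζ B (cubicBracket B hB φ x y) =
      quadElt B φ x * ζ B y - sgn i j • (ζ B y * quadElt B φ x) := by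
  rw [cubicBracket_skew B hB hφ hx hy, map_neg, map_smul, ← two_smul_contr_quadElt B hB hφ hy hx,
    two_smul_contr B hy, twistHom_quadElt B hφ _ hx, sgn_comm j i, smul_sub, smul_mul_assoc,
    smul_smul, sgn_mul_self, one_smul]
  abel

/-- The only place where φ² being scalar enters the Jacobi identity. -/
theorem quadElt_cubicBracket (hφ : φ ∈ evenCubic 𝒱) {c : ℂ}
    (hc : cliffMul B φ φ = algebraMap ℂ _ c) {i j : ZMod 2} {x y : V} (hx : x ∈ 𝒱 i)
    (hy : y ∈ 𝒱 j) :
    quadElt B φ (cubicBracket B hB φ x y) =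
      quadElt B φ x * quadElt B φ y - sgn i j • (quadElt B φ y * quadElt B φ x) := by
  have hsq : (eta B).symm φ * (eta B).symm φ = c • 1 := by
    apply (eta B).injective
    rw [← eta_symm_one B, map_smul, LinearEquiv.apply_symm_apply, ← Algebra.algebraMap_eq_smul_one]
    exact hc
  have h1 := congrArg (contr B B y) hsq
  -- Contracting by y: q(y)φ - φq(y) = 0.
  rw [contr_mul B B hy, twistHom_eta_symm B hφ, map_smul, contr_one, smul_zero] at h1
  change quadElt B φ y * _ + _ * quadElt B φ y = 0 at h1
  have h2 := congrArg (fun t => (2 : ℂ) • contr B B x t) h1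
  -- Contracting by x as well leaves the supercommutator of q(x), q(y) and the anticommutator of φ
  -- with ι(x)q(y).
  simp only [map_add, map_zero, smul_zero, neg_mul, map_neg, contr_mul B B hx,
    twistHom_quadElt B hφ _ hy, twistHom_eta_symm B hφ] at h2
  change (2 : ℂ) • (_ + (_ • _) * quadElt B φ x +
    -(quadElt B φ x * _ + -(_ * _))) = 0 at h2
  have hb := two_smul_contr_quadElt B hB hφ hx hy
  -- Since θ_d φ = -φ, twice q([x,y]) is the anticommutator of [x,y] = 2ι(x)q(y) with φ.
  have h3 := two_smul_contr B (cubicBracket_mem B hB hφ hx hy) ((eta B).symm φ)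
  change (2 : ℂ) • quadElt B φ _ = _ at h3
  rw [twistHom_eta_symm B hφ, ← hb] at h3
  have h4 : (2 : ℂ) • quadElt B φ (cubicBracket B hB φ x y) =
      (2 : ℂ) • (quadElt B φ x * quadElt B φ y - sgn i j • (quadElt B φ y * quadElt B φ x)) := by
    simp only [smul_mul_assoc, mul_smul_comm, neg_mul] at h2 h3
    linear_combination (norm := module) h3 + h2
  exact smul_right_injective _ (two_ne_zero (α := ℂ)) h4

/-- After embedding V in C(V), this is the Jacobi identity for supercommutators of q(x), q(y) and z.
-/
theorem cubicBracket_jacobi (hφ : φ ∈ evenCubic 𝒱) {c : ℂ}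
    (hc : cliffMul B φ φ = algebraMap ℂ _ c) {i j : ZMod 2} {x y : V} (hx : x ∈ 𝒱 i)
    (hy : y ∈ 𝒱 j) (z : V) :
    cubicBracket B hB φ x (cubicBracket B hB φ y z) =
      cubicBracket B hB φ (cubicBracket B hB φ x y) z +
        sgn i j • cubicBracket B hB φ y (cubicBracket B hB φ x z) := by
  suffices h : cubicBracket B hB φ x ∘ₗ cubicBracket B hB φ y =
      cubicBracket B hB φ (cubicBracket B hB φ x y) +
        sgn i j • (cubicBracket B hB φ y ∘ₗ cubicBracket B hB φ x) from LinearMap.congr_fun h z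
  apply hom_ext 𝒱
  intro k z hz
  apply ζ_injective B hB
  have mem {i j : ZMod 2} {x y : V} (hx : x ∈ 𝒱 i) (hy : y ∈ 𝒱 j) :=
    cubicBracket_mem B hB hφ hx hy
  have com {i j : ZMod 2} {x y : V} (hx : x ∈ 𝒱 i) (hy : y ∈ 𝒱 j) :=
    ζ_cubicBracket_eq_commutator B hB hφ hx hy
  simp only [LinearMap.comp_apply, LinearMap.add_apply, LinearMap.smul_apply, map_add, map_smul,
    com hx (mem hy hz), com (mem hx hy) hz, com hy (mem hx hz), com hx hz, com hy hz,
    quadElt_cubicBracket B hB hφ hc hx hy, sgn_comm (i + j) k, sgn_add_right, sgn_comm j i,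
    sgn_comm k i, sgn_comm k j, mul_sub, sub_mul, smul_mul_assoc, mul_smul_comm, mul_assoc]
  linear_combination (norm := module) (sgn_mul_self i j) •
    (sgn j k • (quadElt B φ x * (ζ B z * quadElt B φ y)) -
      (sgn i k * sgn j k) • (ζ B z * (quadElt B φ x * quadElt B φ y)))

/-- The Lie superalgebra with bracket `[x, y] = 2 ι(x) ι(y) φ`. -/
def cubicLie (hφ : φ ∈ evenCubic 𝒱) {c : ℂ} (hc : cliffMul B φ φ = algebraMap ℂ _ c) :
    LieSuperalgebra 𝒱 where
  bracket := cubicBracket B hB φ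
  graded _ _ _ hx _ hy := cubicBracket_mem B hB hφ hx hy
  skew _ _ _ hx _ hy := cubicBracket_skew B hB hφ hx hy
  jacobi _ _ _ hx _ hy z := cubicBracket_jacobi B hB hφ hc hx hy z

/-! ### The value of the Clifford square -/

variable {B} in
-- The constant is 12 = 2 · 2 · 3: the factor 2 in the bracket, then the Euler operator in degrees 2
-- and 3.
theorem sum_ζ_mul_ζ_mul_ζ_cubicBracket (hφ : φ ∈ evenCubic 𝒱) {n : ℕ}
    (b : Module.Basis (Fin n) ℂ V) :
    ∑ i, ∑ j, ζ _ (b i) * (ζ _ (b j) * ζ _ (cubicBracket B hB φ (B.form.dualBasis hB b j)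
      (B.form.dualBasis hB b i))) = (12 : ℂ) • φ := by
  have h1 (i : Fin n) : ∑ j, ζ _ (b j) * ζ _ (cubicBracket B hB φ (B.form.dualBasis hB b j)
      (B.form.dualBasis hB b i)) = (4 : ℂ) • extContr B (B.form.dualBasis hB b i) φ := by
    simp only [ζ_cubicBracket B hB hφ, mul_smul_comm]
    rw [← Finset.smul_sum, sum_ζ_mul_extContr b
      (extContr_mem_extPow B _ (evenCubic_le_extPow hφ)), smul_smul]
    norm_num
  simp only [← Finset.mul_sum, h1, mul_smul_comm]
  rw [← Finset.smul_sum, sum_ζ_mul_extContr b (evenCubic_le_extPow hφ), smul_smul]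
  norm_num

variable {B} in
-- One factor φ is expanded by the previous identity, giving 12; the remaining 2 comes from
-- `form_cubicBracket`.
theorem extAug_cliffMul_self (hφ : φ ∈ evenCubic 𝒱) {n : ℕ} (b : Module.Basis (Fin n) ℂ V) :
    24 * extAug 𝒱 (cliffMul B φ φ) = ∑ i, ∑ j, B.form (b i) (cubicBracket B hB φ (b j)
      (cubicBracket B hB φ (B.form.dualBasis hB b j) (B.form.dualBasis hB b i))) := by
  have h1 : cliffMul B φ φ = gamma B ((eta B).symm φ) φ := by
    rw [cliffMul, eta_apply, map_mul, Module.End.mul_apply, ← eta_apply,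
      LinearEquiv.apply_symm_apply]
  have h2 : (12 : ℂ) * extAug 𝒱 (cliffMul B φ φ) =
      extAug 𝒱 (gamma B ((eta B).symm ((12 : ℂ) • φ)) φ) := by
    simp [h1]
  rw [← sum_ζ_mul_ζ_mul_ζ_cubicBracket hB hφ b] at h2
  simp only [map_sum, LinearMap.sum_apply,
    extAug_gamma_cubic B _ _ _ (evenCubic_le_extPow hφ)] at h2
  simp only [form_cubicBracket B hB hφ (b _), ← Finset.mul_sum, ← h2]
  ring

end Bracket

end

end SuperQuad

end

theorem theorem3p3 {V : Type*} [AddCommGroup V] [Module ℂ V] [FiniteDimensional ℂ V]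
    (𝒱 : ZMod 2 → Submodule ℂ V) [DirectSum.Decomposition 𝒱]
    (B : SuperQuad.SuperForm 𝒱) (hB : B.form.Nondegenerate)
    (φ : SuperQuad.Ext 𝒱) (hφ : φ ∈ SuperQuad.cubicSet B) :
    ∃ L : SuperQuad.LieSuperalgebra 𝒱,
      L.IsQuadratic B ∧
      (∀ z₁ z₂ : V, SuperQuad.ζ (SuperQuad.SuperForm.zero 𝒱) (L.bracket z₁ z₂) =
        (2 : ℂ) • SuperQuad.extContr B z₁ (SuperQuad.extContr B z₂ φ)) ∧
      ∀ (n : ℕ) (b : Module.Basis (Fin n) ℂ V),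
        SuperQuad.cliffMul B φ φ =
          algebraMap ℂ (SuperQuad.Ext 𝒱)
            (1 / 24 * SuperQuad.str 𝒱 (L.envAd (L.casimir B hB b))) := by
  obtain ⟨hφ, c, hc⟩ := hφ
  refine ⟨SuperQuad.cubicLie B hB hφ hc,
    ⟨hB, SuperQuad.cubicBracket_invariant B hB hφ⟩, SuperQuad.ζ_cubicBracket B hB hφ, ?_⟩
  intro n b
  have h := SuperQuad.extAug_cliffMul_self hB hφ b
  -- As the Clifford square is the scalar c, its augmentation is all of it.
  rw [hc, AlgHom.commutes, Algebra.algebraMap_self_apply] at h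
  rw [hc, SuperQuad.str_eq_sum_form (hB := hB) b]
  congr 1
  simp only [SuperQuad.LieSuperalgebra.casimir, map_sum, map_mul,
    SuperQuad.LieSuperalgebra.envAd_envι, LinearMap.sum_apply, Module.End.mul_apply]
  change c = 1 / 24 * ∑ i, ∑ j, B.form (b i) (SuperQuad.cubicBracket B hB φ (b j)
      (SuperQuad.cubicBracket B hB φ (B.form.dualBasis hB b j) (B.form.dualBasis hB b i)))
  rw [← h]
  ring
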